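/- **Setting.** Let $\mathcal C$ be a regular category (finite limits, regular epi–mono factorisations, pullback-stable regular epimorphisms). Relations between objects of $\mathcal C$ are subobjects of products, and conditions on elements are read in the internal logic of $\mathcal C$. $\mathrm{Rel}(\mathcal C)$ is the monoidal dagger category with the objects of $\mathcal C$ and with morphisms $A\to B$ the subobjects of $A\times B$. Composition is composition of relations, $\otimes$ is the product of $\mathcal C$, $I=1$, and $\dagger$ is the converse relation. Every object $A$ is its own dagger dual, $A^*=A$, with $\eta=\{(*,(a,a))\}: I\to A^*\otimes A$ and $\varepsilon=\eta^\dagger: A\otimes A^*\to I$. A *connector* $(A,R,S,p)$ in $\mathcal C$ consists of equivalence relations $R,S$ on $A$ and a morphism $p: R\times_A S\to A$, where $R\times_A S=\{(x,y,z)\mid R(x,y)\wedge S(y,z)\}$, such that - $S(x,p(x,y,z))$ and $R(z,p(x,y,z))$ on $R\times_A S$; - $p(x,y,y)=x$ and $p(y,y,z)=z$ whenever defined; - $p(p(x,y,z),u,v)=p(x,y,p(z,u,v))$, meaning that if one side is defined then so is the other, and they are equal. A *Frobenius 3-structure* on dual objects $A,A^*$ in a monoidal category is a morphism $m: A\otimes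 A^*\otimes A\to A$ such that - (associativity) $m\circ(\mathrm{id}_A\otimes\mathrm{id}_{A^*}\otimes m)=m\circ(m\otimes\mathrm{id}_{A^*}\otimes\mathrm{id}_A)$; - (symmetry) two morphisms $A\to A\otimes A^*\otimes A$ agree: the one obtained from $m$ by bending its second and third inputs around to the right, and the one obtained by bending its first and second inputs around to the left. Their common value is called the comultiplication. It is a *dagger* Frobenius 3-structure if $A,A^*$ are dagger duals and the comultiplication is $m^\dagger$. It is *normal* if both loops $A\to A$, obtained from $m$ by joining its first two inputs (respectively its last two inputs) with the unit of the duality, equal $\mathrm{id}_A$. A *double equivalence relation* on equivalence relations $R,S$ on $A$ is a subobject $\Lambda$ of $A^4$ such that - $R(x,y)\iff\Lambda(x,y,y,x)$ and $S(y,z)\iff\Lambda(y,y,z,z)$; - $\Lambda(x,y,z,u)$ implies $R(x,y)$, $R(z,u)$, $S(y,z)$ and $S(x,u)$; - the relations $r$ on $R$ and $l$ on $S$ given by $(x,y)\,r\,(u,z)\iff\Lambda(x,y,z,u)\iff(y,z)\,l\,(x,u)$ are equivalence relations. **Theorem.** For every object $A$ of $\mathcal C$ there is a bijection between the connectors $(A,R,S,p)$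 in $\mathcal C$ on $A$ and the normal dagger Frobenius 3-structures $m$ on $A$ (with $A^*=A$ as above) in $\mathrm{Rel}(\mathcal C)$. The multiplication $m: A\otimes A\otimes A\to A$ corresponding to $(A,R,S,p)$ is the partial function $(x,y,z)\mapsto p(x,y,z)$ with domain $R\times_A S$, that is, the relation $\{((x,y,z),u)\mid p(x,y,z)\text{ is defined and equals }u\}$. Moreover, $m$, viewed as a subobject $\Lambda$ of $A^4$, is a double equivalence relation on $R$ and $S$; in particular $R$ and $S$ are recovered from $m$ by $R(x,y)\iff\Lambda(x,y,y,x)$ and $S(y,z)\iff\Lambda(y,y,z,z)$. -/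

import Mathlib

open CategoryTheory Limits MonoidalCategory CartesianMonoidalCategory

universe v u

/-! ## Monoidal dagger categories, duals and Frobenius 3-structures -/

section Dagger

/-- A monoidal dagger category: a monoidal category with an involutive, identity-on-objects
contravariant functor `dag` that is compatible with the tensor product and for which the coherence
isomorphisms are unitary. -/
class MonoidalDaggerCategory (D : Type u) [Category.{v} D] [MonoidalCategory D] where
  dag : ∀ {X Y : D}, (X ⟶ Y) → (Y ⟶ X)
  dag_id : ∀ X : D, dag (𝟙 X) = 𝟙 X
  dag_comp : ∀ {X Y Z : D} (f : X ⟶ Y) (g : Y ⟶ Z), dag (f ≫ g) = dag g ≫ dag f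
  dag_dag : ∀ {X Y : D} (f : X ⟶ Y), dag (dag f) = f
  dag_tensor : ∀ {X Y X' Y' : D} (f : X ⟶ Y) (g : X' ⟶ Y'), dag (f ⊗ₘ g) = dag f ⊗ₘ dag g
  dag_associator : ∀ X Y Z : D, dag (α_ X Y Z).hom = (α_ X Y Z).inv
  dag_leftUnitor : ∀ X : D, dag (λ_ X).hom = (λ_ X).inv
  dag_rightUnitor : ∀ X : D, dag (ρ_ X).hom = (ρ_ X).inv

open MonoidalDaggerCategory (dag)

variable {D : Type u} [Category.{v} D] [MonoidalCategory D]

/-- Two-sided dual objects `A`, `A'`: `A'` is a left dual of `A` (through `η` and `ε`), and `A` is a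
left dual of `A'` (through `η'` and `ε'`). -/
structure TwoSidedDual (A A' : D) where
  left : ExactPairing A' A
  right : ExactPairing A A'

namespace TwoSidedDual

variable {A A' : D} (d : TwoSidedDual A A')

/-- The unit `η : I ⟶ A' ⊗ A`. -/
def η : 𝟙_ D ⟶ A' ⊗ A := d.left.coevaluation'

/-- The counit `ε : A ⊗ A' ⟶ I`. -/
def ε : A ⊗ A' ⟶ 𝟙_ D := d.left.evaluation'

/-- The unit `η' : I ⟶ A ⊗ A'`. -/
def η' : 𝟙_ D ⟶ A ⊗ A' := d.right.coevaluation'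

/-- The counit `ε' : A' ⊗ A ⟶ I`. -/
def ε' : A' ⊗ A ⟶ 𝟙_ D := d.right.evaluation'

/-- A dagger dual: `η' = ε†` and `ε' = η†`. -/
def IsDagger [MonoidalDaggerCategory D] : Prop :=
  d.η' = dag d.ε ∧ d.ε' = dag d.η

/-- Rotation of a ternary operation `m : A ⊗ A' ⊗ A ⟶ A` into `A ⟶ A ⊗ A' ⊗ A`: the first input
stays, the second and third inputs are bent around to the right, becoming the third and second
outputs. -/
def bendRight (m : A ⊗ A' ⊗ A ⟶ A) : A ⟶ A ⊗ A' ⊗ A :=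
  (ρ_ A).inv ≫
    A ◁ (d.η ≫ A' ◁ ((λ_ A).inv ≫ d.η' ▷ A ≫ (α_ A A' A).hom) ≫ (α_ A' A (A' ⊗ A)).inv) ≫
    (α_ A (A' ⊗ A) (A' ⊗ A)).inv ≫ m ▷ (A' ⊗ A)

/-- The mirror image: the third input stays, the first and second inputs are bent around to the
left, becoming the second and first outputs. -/
def bendLeft (m : A ⊗ A' ⊗ A ⟶ A) : A ⟶ A ⊗ A' ⊗ A :=
  (λ_ A).inv ≫
    (d.η' ≫ ((ρ_ A).inv ≫ A ◁ d.η ≫ (α_ A A' A).inv) ▷ A' ≫ (α_ (A ⊗ A') A A').hom) ▷ A ≫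
    (α_ (A ⊗ A') (A ⊗ A') A).hom ≫ (A ⊗ A') ◁ (α_ A A' A).hom ≫
    (A ⊗ A') ◁ m ≫ (α_ A A' A).hom

/-- The left loop of `m`: its first two inputs are joined. -/
def leftLoop (m : A ⊗ A' ⊗ A ⟶ A) : A ⟶ A :=
  (λ_ A).inv ≫ d.η' ▷ A ≫ (α_ A A' A).hom ≫ m

/-- The right loop of `m`: its last two inputs are joined. -/
def rightLoop (m : A ⊗ A' ⊗ A ⟶ A) : A ⟶ A :=
  (ρ_ A).inv ≫ A ◁ d.η ≫ m

end TwoSidedDual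

/-- A Frobenius 3-structure on dual objects `A`, `A'`: a multiplication `A ⊗ A' ⊗ A ⟶ A` that is
associative, `[x, y, [z, u, v]] = [[x, y, z], u, v]`, and symmetric. -/
@[ext]
structure Frobenius3Structure {A A' : D} (d : TwoSidedDual A A') where
  mul : A ⊗ A' ⊗ A ⟶ A
  assoc : A ◁ A' ◁ mul ≫ mul =
    A ◁ (α_ A' A (A' ⊗ A)).inv ≫ (α_ A (A' ⊗ A) (A' ⊗ A)).inv ≫ mul ▷ (A' ⊗ A) ≫ mul
  symm : d.bendRight mul = d.bendLeft mul

namespace Frobenius3Structure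

variable {A A' : D} {d : TwoSidedDual A A'}

/-- The comultiplication: the common value of the two rotations of the multiplication. -/
def comul (F : Frobenius3Structure d) : A ⟶ A ⊗ A' ⊗ A := d.bendRight F.mul

/-- A dagger Frobenius 3-structure: the duals are dagger duals, and the comultiplication is the
dagger of the multiplication. -/
def IsDagger [MonoidalDaggerCategory D] (F : Frobenius3Structure d) : Prop :=
  d.IsDagger ∧ F.comul = dag F.mul

/-- Normality: the left loop and the right loop are both identities. -/
def IsNormal (F : Frobenius3Structure d) : Prop :=
  d.leftLoop F.mul = 𝟙 A ∧ d.rightLoop F.mul = 𝟙 A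

end Frobenius3Structure

/-- Normal dagger Frobenius 3-structures on the dual objects `A`, `A'`. -/
abbrev NormalDaggerFrobenius3Structure [MonoidalDaggerCategory D] {A A' : D}
    (d : TwoSidedDual A A') :=
  {F : Frobenius3Structure d // F.IsDagger ∧ F.IsNormal}

end Dagger

noncomputable section

/-! ## The monoidal dagger category of relations in a regular category -/

section Covers

variable {C : Type u} [Category.{v} C]

theorem factors_of_strongEpi {X Y Z : C} (P : Subobject Z) (e : Y ⟶ X) [StrongEpi e] (f : X ⟶ Z)
    (h : P.Factors (e ≫ f)) : P.Factors f := by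
  have sq : CommSq (P.factorThru _ h) e P.arrow f := ⟨by simp⟩
  rw [← sq.fac_right]
  exact P.factors_comp_arrow _

theorem subobject_factors_iff {X Z : C} (P : Subobject Z) (f : X ⟶ Z) :
    P.Factors f ↔ ∃ k : X ⟶ (P : C), k ≫ P.arrow = f :=
  ⟨fun h => ⟨P.factorThru f h, by simp⟩, fun ⟨k, hk⟩ => hk ▸ P.factors_comp_arrow k⟩

theorem subobject_mk_factors_iff {X Y Z : C} (m : Y ⟶ Z) [Mono m] (f : X ⟶ Z) :
    (Subobject.mk m).Factors f ↔ ∃ k : X ⟶ Y, k ≫ m = f :=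
  Subobject.mk_factors_iff m f

variable [Regular C]

theorem strongEpi_pullback_fst {X Y Z : C} (f : X ⟶ Z) (g : Y ⟶ Z) [StrongEpi g] :
    StrongEpi (pullback.fst f g) := by
  have : IsRegularEpi g := inferInstance
  infer_instance

theorem strongEpi_factorThruImageSubobject {X Y : C} (f : X ⟶ Y) :
    StrongEpi (factorThruImageSubobject f) := by
  unfold factorThruImageSubobject
  exact strongEpi_comp _ _

theorem imageSubobject_factors_iff {X Y Z : C} (f : X ⟶ Z) (g : Y ⟶ Z) :
    (imageSubobject f).Factors g ↔ ∃ (W : C) (e : W ⟶ Y) (_ : StrongEpi e) (k : W ⟶ X),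
      k ≫ f = e ≫ g := by
  constructor
  · intro h
    obtain ⟨k, hk⟩ := (subobject_factors_iff _ _).1 h
    have := strongEpi_factorThruImageSubobject f
    refine ⟨_, _, strongEpi_pullback_fst k (factorThruImageSubobject f), pullback.snd _ _, ?_⟩
    rw [← hk, pullback.condition_assoc, imageSubobject_arrow_comp]
  · rintro ⟨W, e, he, k, hk⟩
    apply factors_of_strongEpi _ e
    rw [← hk]
    exact imageSubobject_factors_comp_self f k

end Covers

/-- A relation from `A` to `B`: a subobject of the product of `A` and `B`. -/
@[ext]
structure IRel {C : Type u} [Category.{v} C] [CartesianMonoidalCategory C] (A B : C) where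
  sub : Subobject (A ⊗ B)

namespace IRel

section

variable {C : Type u} [Category.{v} C] [CartesianMonoidalCategory C] {A B E A' B' : C}

/-- `R.Holds a b`: the generalised elements `a`, `b` (of the same shape) satisfy `R(a, b)`. -/
def Holds (R : IRel A B) {X : C} (a : X ⟶ A) (b : X ⟶ B) : Prop :=
  R.sub.Factors (lift a b)

theorem holds_iff (R : IRel A B) {X : C} (a : X ⟶ A) (b : X ⟶ B) :
    R.Holds a b ↔ ∃ k : X ⟶ (R.sub : C),
      k ≫ R.sub.arrow ≫ fst A B = a ∧ k ≫ R.sub.arrow ≫ snd A B = b := by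
  unfold Holds
  rw [subobject_factors_iff]
  constructor
  · rintro ⟨k, hk⟩
    exact ⟨k, by rw [reassoc_of% hk, lift_fst], by rw [reassoc_of% hk, lift_snd]⟩
  · rintro ⟨k, rfl, rfl⟩
    exact ⟨k, by ext <;> simp⟩

theorem ext_holds {R S : IRel A B}
    (h : ∀ (X : C) (a : X ⟶ A) (b : X ⟶ B), R.Holds a b ↔ S.Holds a b) : R = S := by
  have key : ∀ {R S : IRel A B},
      (∀ (X : C) (a : X ⟶ A) (b : X ⟶ B), R.Holds a b → S.Holds a b) → R.sub ≤ S.sub := by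
    intro R S h
    apply Subobject.le_of_factors
    have := h _ (R.sub.arrow ≫ fst _ _) (R.sub.arrow ≫ snd _ _)
    simp only [Holds, lift_comp_fst_snd] at this
    exact this R.sub.factors_self
  exact IRel.ext (le_antisymm (key fun X a b => (h X a b).1) (key fun X a b => (h X a b).2))

theorem Holds.precomp {R : IRel A B} {X : C} {a : X ⟶ A} {b : X ⟶ B} (h : R.Holds a b) {Y : C}
    (f : Y ⟶ X) : R.Holds (f ≫ a) (f ≫ b) := by
  unfold Holds at *
  rw [← comp_lift]
  exact Subobject.factors_of_factors_right f h

theorem holds_of_cover {R : IRel A B} {X Y : C} (e : Y ⟶ X) [StrongEpi e] {a : X ⟶ A} {b : X ⟶ B}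
    (h : R.Holds (e ≫ a) (e ≫ b)) : R.Holds a b := by
  unfold Holds at *
  rw [← comp_lift] at h
  exact factors_of_strongEpi _ e _ h

/-- The graph of a morphism of the base category. -/
def graph (f : A ⟶ B) : IRel A B := ⟨Subobject.mk (lift (𝟙 A) f)⟩

theorem holds_graph (f : A ⟶ B) {X : C} (a : X ⟶ A) (b : X ⟶ B) :
    (graph f).Holds a b ↔ a ≫ f = b := by
  unfold Holds graph
  rw [subobject_mk_factors_iff]
  constructor
  · rintro ⟨g, hg⟩
    have h1 := congrArg (· ≫ fst _ _) hg
    have h2 := congrArg (· ≫ snd _ _) hg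
    simp only [comp_lift, Category.comp_id, lift_fst, lift_snd] at h1 h2
    rw [← h1, h2]
  · rintro rfl
    exact ⟨a, by simp⟩

end

section

variable {C : Type u} [Category.{v} C] [CartesianMonoidalCategory C] [Regular C]
  {A B E A' B' : C}

/-- The canonical morphism `R ×_B S ⟶ A ⊗ E`. -/
def compSpan (R : IRel A B) (S : IRel B E) :
    pullback (R.sub.arrow ≫ snd A B) (S.sub.arrow ≫ fst B E) ⟶ A ⊗ E :=
  lift (pullback.fst _ _ ≫ R.sub.arrow ≫ fst A B) (pullback.snd _ _ ≫ S.sub.arrow ≫ snd B E)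

/-- Composition of relations, `∃ b, R(a, b) ∧ S(b, e)`: the image of `R ×_B S ⟶ A ⊗ E`. -/
def comp (R : IRel A B) (S : IRel B E) : IRel A E :=
  ⟨imageSubobject (compSpan R S)⟩

theorem holds_comp (R : IRel A B) (S : IRel B E) {X : C} (a : X ⟶ A) (c : X ⟶ E) :
    (R.comp S).Holds a c ↔ ∃ (Y : C) (e : Y ⟶ X) (_ : StrongEpi e) (b : Y ⟶ B),
      R.Holds (e ≫ a) b ∧ S.Holds b (e ≫ c) := by
  change (imageSubobject (compSpan R S)).Factors _ ↔ _
  rw [imageSubobject_factors_iff]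
  refine exists_congr fun W => exists_congr fun e => exists_congr fun _ => ?_
  constructor
  · rintro ⟨k, hk⟩
    have h1 := congrArg (· ≫ fst _ _) hk
    have h2 := congrArg (· ≫ snd _ _) hk
    simp only [compSpan, Category.assoc, lift_fst, lift_snd] at h1 h2
    refine ⟨k ≫ pullback.fst _ _ ≫ R.sub.arrow ≫ snd A B, ?_, ?_⟩
    · rw [holds_iff]
      exact ⟨k ≫ pullback.fst _ _, by simpa using h1, by simp⟩
    · rw [holds_iff]
      exact ⟨k ≫ pullback.snd _ _, by simp [pullback.condition], by simpa using h2⟩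
  · rintro ⟨b, hR, hS⟩
    obtain ⟨k, hk1, hk2⟩ := (holds_iff _ _ _).1 hR
    obtain ⟨l, hl1, hl2⟩ := (holds_iff _ _ _).1 hS
    refine ⟨pullback.lift k l (by rw [hk2, hl1]), ?_⟩
    ext
    · simp only [compSpan, Category.assoc, lift_fst]
      rw [pullback.lift_fst_assoc, hk1]
    · simp only [compSpan, Category.assoc, lift_snd]
      rw [pullback.lift_snd_assoc, hl2]

theorem holds_graph_comp (f : A ⟶ B) (S : IRel B E) {X : C} (a : X ⟶ A) (c : X ⟶ E) :
    ((graph f).comp S).Holds a c ↔ S.Holds (a ≫ f) c := by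
  rw [holds_comp]
  constructor
  · rintro ⟨Y, e, he, b, h1, h2⟩
    rw [holds_graph] at h1
    subst h1
    exact holds_of_cover e (by simpa using h2)
  · intro h
    exact ⟨X, 𝟙 X, inferInstance, a ≫ f, by simp [holds_graph], by simpa using h⟩

theorem holds_comp_graph (R : IRel A B) (f : B ≅ E) {X : C} (a : X ⟶ A) (c : X ⟶ E) :
    (R.comp (graph f.hom)).Holds a c ↔ R.Holds a (c ≫ f.inv) := by
  rw [holds_comp]
  constructor
  · rintro ⟨Y, e, he, b, h1, h2⟩
    rw [holds_graph, ← Iso.eq_comp_inv] at h2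
    subst h2
    exact holds_of_cover e (by simpa using h1)
  · intro h
    exact ⟨X, 𝟙 X, inferInstance, c ≫ f.inv, by simpa using h, by simp [holds_graph]⟩

theorem comp_assoc {F : C} (R : IRel A B) (S : IRel B E) (T : IRel E F) :
    (R.comp S).comp T = R.comp (S.comp T) := by
  apply ext_holds
  intro X a c
  rw [holds_comp, holds_comp]
  constructor
  · rintro ⟨Y, e, he, b, h1, h2⟩
    obtain ⟨Z, e', he', b', h3, h4⟩ := (holds_comp _ _ _ _).1 h1
    refine ⟨Z, e' ≫ e, strongEpi_comp _ _, b', by simpa using h3, ?_⟩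
    rw [holds_comp]
    exact ⟨Z, 𝟙 Z, inferInstance, e' ≫ b, by simpa using h4, by simpa using h2.precomp e'⟩
  · rintro ⟨Y, e, he, b, h1, h2⟩
    obtain ⟨Z, e', he', b', h3, h4⟩ := (holds_comp _ _ _ _).1 h2
    refine ⟨Z, e' ≫ e, strongEpi_comp _ _, b', ?_, by simpa using h4⟩
    rw [holds_comp]
    exact ⟨Z, 𝟙 Z, inferInstance, e' ≫ b, by simpa using h1.precomp e', by simpa using h3⟩

/-- The converse relation `{(b, a) | R(a, b)}`. -/
def converse (R : IRel A B) : IRel B A :=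
  ⟨(Subobject.pullback (lift (snd B A) (fst B A))).obj R.sub⟩

theorem holds_converse (R : IRel A B) {X : C} (b : X ⟶ B) (a : X ⟶ A) :
    R.converse.Holds b a ↔ R.Holds a b := by
  unfold Holds converse
  rw [pullback_factors_iff]
  simp

/-- The tensor product of relations, `{((a, a'), (b, b')) | R(a, b) ∧ S(a', b')}`. -/
def tensor (R : IRel A B) (S : IRel A' B') : IRel (A ⊗ A') (B ⊗ B') :=
  ⟨(Subobject.pullback (fst A A' ⊗ₘ fst B B')).obj R.sub ⊓
    (Subobject.pullback (snd A A' ⊗ₘ snd B B')).obj S.sub⟩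

theorem holds_tensor (R : IRel A B) (S : IRel A' B') {X : C} (a : X ⟶ A ⊗ A') (b : X ⟶ B ⊗ B') :
    (R.tensor S).Holds a b ↔
      R.Holds (a ≫ fst A A') (b ≫ fst B B') ∧ S.Holds (a ≫ snd A A') (b ≫ snd B B') := by
  unfold Holds tensor
  simp only [Subobject.inf_factors, pullback_factors_iff, lift_map]

theorem graph_id_comp (R : IRel A B) : (graph (𝟙 A)).comp R = R :=
  ext_holds fun X a b => by rw [holds_graph_comp, Category.comp_id]

theorem comp_graph_id (R : IRel A B) : R.comp (graph (𝟙 B)) = R :=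
  ext_holds fun X a b => by
    rw [← Iso.refl_hom, holds_comp_graph]
    simp

theorem graph_comp_graph (f : A ⟶ B) (g : B ⟶ E) :
    (graph f).comp (graph g) = graph (f ≫ g) :=
  ext_holds fun X a b => by simp [holds_graph_comp, holds_graph]

theorem graph_tensor_graph (f : A ⟶ B) (g : A' ⟶ B') :
    (graph f).tensor (graph g) = graph (f ⊗ₘ g) :=
  ext_holds fun X a b => by
    simp only [holds_tensor, holds_graph]
    constructor
    · rintro ⟨h1, h2⟩
      rw [Category.assoc] at h1 h2
      ext <;> simp [h1, h2]
    · rintro rfl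
      simp

theorem converse_graph (f : A ≅ B) : (graph f.hom).converse = graph f.inv :=
  ext_holds fun X a b => by
    simp only [holds_converse, holds_graph]
    rw [← Iso.eq_comp_inv, eq_comm]

end

end IRel

/-- The category `Rel(C)`: its objects are those of `C`. -/
structure RelCategory (C : Type u) where
  obj : C

namespace RelCategory

variable {C : Type u} [Category.{v} C] [CartesianMonoidalCategory C] [Regular C]

instance : Category (RelCategory C) where
  Hom A B := IRel A.obj B.obj
  id A := IRel.graph (𝟙 A.obj)
  comp R S := R.comp S
  id_comp R := IRel.graph_id_comp R
  comp_id R := IRel.comp_graph_id R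
  assoc R S T := IRel.comp_assoc R S T

/-- The graph of an isomorphism of `C`, as an isomorphism of `Rel(C)`. -/
def graphIso {A B : C} (f : A ≅ B) : (⟨A⟩ : RelCategory C) ≅ ⟨B⟩ where
  hom := IRel.graph f.hom
  inv := IRel.graph f.inv
  hom_inv_id := (IRel.graph_comp_graph _ _).trans (by rw [f.hom_inv_id]; rfl)
  inv_hom_id := (IRel.graph_comp_graph _ _).trans (by rw [f.inv_hom_id]; rfl)

/-- The tensor product of `Rel(C)` is the product of `C`, and its coherence isomorphisms are the
graphs of those of `C`. -/
instance : MonoidalCategoryStruct (RelCategory C) where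
  tensorObj A B := ⟨A.obj ⊗ B.obj⟩
  tensorHom R S := IRel.tensor R S
  whiskerLeft A _ _ R := IRel.tensor (IRel.graph (𝟙 A.obj)) R
  whiskerRight R A := IRel.tensor R (IRel.graph (𝟙 A.obj))
  tensorUnit := ⟨𝟙_ C⟩
  associator A B E := graphIso (α_ A.obj B.obj E.obj)
  leftUnitor A := graphIso (λ_ A.obj)
  rightUnitor A := graphIso (ρ_ A.obj)

theorem tensor_comp_tensor {A B E A' B' E' : C} (R : IRel A B) (R' : IRel A' B') (S : IRel B E)
    (S' : IRel B' E') :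
    (R.tensor R').comp (S.tensor S') = (R.comp S).tensor (R'.comp S') := by
  apply IRel.ext_holds
  intro X a c
  rw [IRel.holds_tensor, IRel.holds_comp]
  simp only [IRel.holds_tensor]
  constructor
  · rintro ⟨Y, e, he, b, ⟨h1, h2⟩, h3, h4⟩
    exact ⟨(IRel.holds_comp _ _ _ _).2 ⟨Y, e, he, _, by simpa using h1, by simpa using h3⟩,
      (IRel.holds_comp _ _ _ _).2 ⟨Y, e, he, _, by simpa using h2, by simpa using h4⟩⟩
  · rintro ⟨h1, h2⟩
    obtain ⟨Y, e, he, b, h1, h3⟩ := (IRel.holds_comp _ _ _ _).1 h1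
    obtain ⟨Z, e', he', b', h2, h4⟩ := (IRel.holds_comp _ _ _ _).1 h2
    have := strongEpi_pullback_fst e e'
    refine ⟨pullback e e', pullback.fst e e' ≫ e, strongEpi_comp _ _,
      lift (pullback.fst e e' ≫ b) (pullback.snd e e' ≫ b'), ⟨?_, ?_⟩, ?_, ?_⟩
    · simpa using h1.precomp (pullback.fst e e')
    · rw [pullback.condition]
      simpa using h2.precomp (pullback.snd e e')
    · simpa using h3.precomp (pullback.fst e e')
    · rw [pullback.condition]
      simpa using h4.precomp (pullback.snd e e')

instance : MonoidalCategory (RelCategory C) := .ofTensorHom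
  (id_tensorHom_id := fun A B => (IRel.graph_tensor_graph _ _).trans (by
    rw [id_tensorHom_id]; rfl))
  (id_tensorHom := fun _ _ _ _ => rfl)
  (tensorHom_id := fun _ _ => rfl)
  (tensorHom_comp_tensorHom := fun R R' S S' => tensor_comp_tensor R R' S S')
  (associator_naturality := fun {A₁ A₂ A₃ B₁ B₂ B₃} R S T => by
    change ((IRel.tensor (IRel.tensor R S) T).comp
        (IRel.graph (α_ B₁.obj B₂.obj B₃.obj).hom) : IRel _ _) =
      (IRel.graph (α_ A₁.obj A₂.obj A₃.obj).hom).comp (IRel.tensor R (IRel.tensor S T))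
    apply IRel.ext_holds
    intro X a c
    simp only [IRel.holds_graph_comp, IRel.holds_comp_graph, IRel.holds_tensor, Category.assoc,
      associator_hom_fst, associator_hom_snd_fst, associator_hom_snd_snd, associator_inv_fst_fst,
      associator_inv_fst_snd, associator_inv_snd, and_assoc])
  (leftUnitor_naturality := fun {A B} R => by
    change (IRel.tensor (IRel.graph (𝟙 (𝟙_ C))) R).comp (IRel.graph (λ_ B.obj).hom) =
      (IRel.graph (λ_ A.obj).hom).comp R
    apply IRel.ext_holds
    intro X a c
    rw [IRel.holds_graph_comp, IRel.holds_comp_graph, IRel.holds_tensor, IRel.holds_graph]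
    simp [leftUnitor_hom]
    exact fun _ => toUnit_unique _ _)
  (rightUnitor_naturality := fun {A B} R => by
    change (IRel.tensor R (IRel.graph (𝟙 (𝟙_ C)))).comp (IRel.graph (ρ_ B.obj).hom) =
      (IRel.graph (ρ_ A.obj).hom).comp R
    apply IRel.ext_holds
    intro X a c
    rw [IRel.holds_graph_comp, IRel.holds_comp_graph, IRel.holds_tensor, IRel.holds_graph]
    simp [rightUnitor_hom]
    exact fun _ => toUnit_unique _ _)
  (pentagon := fun A B E F => by
    change (IRel.tensor (IRel.graph (α_ A.obj B.obj E.obj).hom) (IRel.graph (𝟙 F.obj))).comp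
      ((IRel.graph (α_ A.obj (B.obj ⊗ E.obj) F.obj).hom).comp
        (IRel.tensor (IRel.graph (𝟙 A.obj)) (IRel.graph (α_ B.obj E.obj F.obj).hom))) =
      (IRel.graph (α_ (A.obj ⊗ B.obj) E.obj F.obj).hom).comp
        (IRel.graph (α_ A.obj B.obj (E.obj ⊗ F.obj)).hom)
    simp only [IRel.graph_tensor_graph, IRel.graph_comp_graph, tensorHom_id, id_tensorHom,
      MonoidalCategory.pentagon])
  (triangle := fun A B => by
    change (IRel.graph (α_ A.obj (𝟙_ C) B.obj).hom).comp
      (IRel.tensor (IRel.graph (𝟙 A.obj)) (IRel.graph (λ_ B.obj).hom)) =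
      IRel.tensor (IRel.graph (ρ_ A.obj).hom) (IRel.graph (𝟙 B.obj))
    simp only [IRel.graph_tensor_graph, IRel.graph_comp_graph, tensorHom_id, id_tensorHom,
      MonoidalCategory.triangle])

/-- The dagger of `Rel(C)` is the converse of a relation. -/
instance : MonoidalDaggerCategory (RelCategory C) where
  dag R := IRel.converse R
  dag_id A := IRel.converse_graph (Iso.refl A.obj)
  dag_comp {A B E} R S := by
    change (IRel.comp R S).converse = (IRel.converse S).comp (IRel.converse R)
    apply IRel.ext_holds
    intro X a c
    rw [IRel.holds_converse, IRel.holds_comp, IRel.holds_comp]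
    simp only [IRel.holds_converse, and_comm]
  dag_dag R := IRel.ext_holds fun X a c => by rw [IRel.holds_converse, IRel.holds_converse]
  dag_tensor R S := by
    change (IRel.tensor R S).converse = (IRel.converse R).tensor (IRel.converse S)
    apply IRel.ext_holds
    intro X a c
    simp only [IRel.holds_converse, IRel.holds_tensor]
  dag_associator A B E := IRel.converse_graph (α_ A.obj B.obj E.obj)
  dag_leftUnitor A := IRel.converse_graph (λ_ A.obj)
  dag_rightUnitor A := IRel.converse_graph (ρ_ A.obj)

/-- The relation `{(*, (a, a))}` from the terminal object to `A ⊗ A`. -/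
def diagUnit (A : C) : IRel (𝟙_ C) (A ⊗ A) :=
  ⟨(Subobject.pullback (snd (𝟙_ C) (A ⊗ A))).obj (Subobject.mk (lift (𝟙 A) (𝟙 A)))⟩

theorem holds_diagUnit (A : C) {X : C} (t : X ⟶ 𝟙_ C) (a : X ⟶ A ⊗ A) :
    (diagUnit A).Holds t a ↔ a ≫ fst A A = a ≫ snd A A := by
  unfold diagUnit IRel.Holds
  rw [pullback_factors_iff, subobject_mk_factors_iff, lift_snd]
  constructor
  · rintro ⟨k, rfl⟩
    simp
  · intro h
    refine ⟨a ≫ fst A A, ?_⟩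
    ext <;> simp [h]

/-- Every object `A` of `Rel(C)` is left dual to itself, with `η = {(*, (a, a))}` and
`ε = {((a, a), *)}`. -/
@[reducible]
def selfPairing (A : C) : ExactPairing (⟨A⟩ : RelCategory C) ⟨A⟩ where
  coevaluation' := diagUnit A
  evaluation' := (diagUnit A).converse
  coevaluation_evaluation' := by
    change (IRel.tensor (IRel.graph (𝟙 A)) (diagUnit A)).comp
      ((IRel.graph (α_ A A A).inv).comp
        (IRel.tensor (diagUnit A).converse (IRel.graph (𝟙 A)))) =
      (IRel.graph (ρ_ A).hom).comp (IRel.graph (λ_ A).inv)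
    apply IRel.ext_holds
    intro X a c
    rw [IRel.graph_comp_graph, IRel.holds_comp]
    simp only [IRel.holds_graph_comp, IRel.holds_tensor, IRel.holds_graph, IRel.holds_converse,
      holds_diagUnit, Category.assoc, Category.comp_id, associator_inv_fst_fst, associator_inv_fst_snd,
      associator_inv_snd]
    constructor
    · rintro ⟨Y, e, he, b, ⟨h1, h2⟩, h3, h4⟩
      rw [← Category.assoc, Iso.comp_inv_eq, ← cancel_epi e]
      simp only [rightUnitor_hom, leftUnitor_hom]
      rw [h1, h3, h2, h4]
    · intro h
      rw [← Category.assoc, Iso.comp_inv_eq, rightUnitor_hom, leftUnitor_hom] at h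
      refine ⟨X, 𝟙 X, inferInstance,
        lift (a ≫ fst _ _) (lift (a ≫ fst _ _) (a ≫ fst _ _)), ⟨?_, ?_⟩, ?_, ?_⟩ <;> simp [h]
  evaluation_coevaluation' := by
    change (IRel.tensor (diagUnit A) (IRel.graph (𝟙 A))).comp
      ((IRel.graph (α_ A A A).hom).comp
        (IRel.tensor (IRel.graph (𝟙 A)) (diagUnit A).converse)) =
      (IRel.graph (λ_ A).hom).comp (IRel.graph (ρ_ A).inv)
    apply IRel.ext_holds
    intro X a c
    rw [IRel.graph_comp_graph, IRel.holds_comp]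
    simp only [IRel.holds_graph_comp, IRel.holds_tensor, IRel.holds_graph, IRel.holds_converse,
      holds_diagUnit, Category.assoc, Category.comp_id, associator_hom_fst, associator_hom_snd_fst,
      associator_hom_snd_snd]
    constructor
    · rintro ⟨Y, e, he, b, ⟨h1, h2⟩, h3, h4⟩
      rw [← Category.assoc, Iso.comp_inv_eq, ← cancel_epi e]
      simp only [rightUnitor_hom, leftUnitor_hom]
      rw [h2, ← h4, ← h1, h3]
    · intro h
      rw [← Category.assoc, Iso.comp_inv_eq, rightUnitor_hom, leftUnitor_hom] at h
      refine ⟨X, 𝟙 X, inferInstance,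
        lift (lift (a ≫ snd _ _) (a ≫ snd _ _)) (a ≫ snd _ _), ⟨?_, ?_⟩, ?_, ?_⟩ <;> simp [h]

/-- The self-duality of an object of `Rel(C)`. -/
def selfDual (A : C) : TwoSidedDual (⟨A⟩ : RelCategory C) ⟨A⟩ where
  left := selfPairing A
  right := selfPairing A

end RelCategory

/-! ## Connectors and double equivalence relations -/

section Connectors

variable {C : Type u} [Category.{v} C] [CartesianMonoidalCategory C]

/-- An internal equivalence relation on `A`. -/
def IRel.IsEquiv {A : C} (R : IRel A A) : Prop :=
  IsEquivalenceRelation (R.sub.arrow ≫ fst A A) (R.sub.arrow ≫ snd A A)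

variable [Regular C]

/-- The object `R ×_A S` of triples `(x, y, z)` with `R(x, y)` and `S(y, z)`. -/
abbrev tripleObj {A : C} (R S : IRel A A) : C :=
  pullback (R.sub.arrow ≫ snd A A) (S.sub.arrow ≫ fst A A)

/-- The inclusion of `R ×_A S` in `A ⊗ A ⊗ A`. -/
def tripleMap {A : C} (R S : IRel A A) : tripleObj R S ⟶ A ⊗ A ⊗ A :=
  lift (pullback.fst _ _ ≫ R.sub.arrow ≫ fst A A)
    (lift (pullback.fst _ _ ≫ R.sub.arrow ≫ snd A A)
      (pullback.snd _ _ ≫ S.sub.arrow ≫ snd A A))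

instance {A : C} (R S : IRel A A) : Mono (tripleMap R S) where
  right_cancellation {Z} g h w := by
    have h1 := congrArg (· ≫ fst _ _) w
    have h2 := congrArg (· ≫ snd _ _ ≫ fst _ _) w
    have h3 := congrArg (· ≫ snd _ _ ≫ snd _ _) w
    simp only [tripleMap, Category.assoc, lift_fst, lift_snd, lift_snd_assoc] at h1 h2 h3
    have e1 : g ≫ pullback.fst _ _ = h ≫ pullback.fst _ _ := by
      rw [← cancel_mono R.sub.arrow]
      ext
      · simpa using h1
      · simpa using h2
    apply pullback.hom_ext e1
    rw [← cancel_mono S.sub.arrow]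
    ext
    · simp only [Category.assoc]
      rw [← pullback.condition]
      exact h2
    · simpa using h3

/-- For a partial operation `p : R ×_A S ⟶ A` and generalised elements `x, y, z, u` of `A`:
`p(x, y, z)` is defined and equal to `u`. -/
def Yields {A : C} {R S : IRel A A} (p : tripleObj R S ⟶ A) {X : C} (x y z u : X ⟶ A) : Prop :=
  ∃ k : X ⟶ tripleObj R S, k ≫ tripleMap R S = lift x (lift y z) ∧ k ≫ p = u

/-- A connector on `A`: equivalence relations `R` and `S` on `A` and a morphism
`p : R ×_A S ⟶ A` with
* `S(x, p(x, y, z))` and `R(z, p(x, y, z))` for all `(x, y, z)` in `R ×_A S`;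
* `p(x, y, y) = x` and `p(y, y, z) = z` whenever defined;
* `p(p(x, y, z), u, v) = p(x, y, p(z, u, v))`: if one side is defined, then so is the other, and
  they are equal. -/
structure Connector (A : C) where
  R : IRel A A
  S : IRel A A
  R_equiv : R.IsEquiv
  S_equiv : S.IsEquiv
  p : tripleObj R S ⟶ A
  S_p : ∀ {X : C} (x y z u : X ⟶ A), Yields p x y z u → S.Holds x u
  R_p : ∀ {X : C} (x y z u : X ⟶ A), Yields p x y z u → R.Holds z u
  p_right : ∀ {X : C} (x y u : X ⟶ A), Yields p x y y u → u = x
  p_left : ∀ {X : C} (y z u : X ⟶ A), Yields p y y z u → u = z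
  p_assoc : ∀ {X : C} (x y z u v w : X ⟶ A),
    (∃ t, Yields p x y z t ∧ Yields p t u v w) ↔ (∃ t, Yields p z u v t ∧ Yields p x y t w)

/-- The partial function `(x, y, z) ↦ p(x, y, z)`, defined on `R ×_A S`, as a relation. -/
def Connector.toRel {A : C} (c : Connector A) : IRel (A ⊗ A ⊗ A) A :=
  ⟨Subobject.mk (lift (tripleMap c.R c.S) c.p)⟩

/-- A ternary operation in `Rel(C)` as a quaternary relation `L(x, y, z, u)` on `A`. -/
def Quad {A : C} (L : IRel (A ⊗ A ⊗ A) A) {X : C} (x y z u : X ⟶ A) : Prop :=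
  L.Holds (lift x (lift y z)) u

/-- The relation `(x, y) r (u, z) ↔ L(x, y, z, u)`, as a relation on the object `R`. -/
def horizontal {A : C} (R : IRel A A) (L : IRel (A ⊗ A ⊗ A) A) :
    IRel (R.sub : C) (R.sub : C) :=
  let q := R.sub.arrow ⊗ₘ R.sub.arrow
  ⟨(Subobject.pullback (lift
    (lift (q ≫ fst _ _ ≫ fst _ _) (lift (q ≫ fst _ _ ≫ snd _ _) (q ≫ snd _ _ ≫ snd _ _)))
    (q ≫ snd _ _ ≫ fst _ _))).obj L.sub⟩

/-- The relation `(y, z) l (x, u) ↔ L(x, y, z, u)`, as a relation on the object `S`. -/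
def vertical {A : C} (S : IRel A A) (L : IRel (A ⊗ A ⊗ A) A) :
    IRel (S.sub : C) (S.sub : C) :=
  let q := S.sub.arrow ⊗ₘ S.sub.arrow
  ⟨(Subobject.pullback (lift
    (lift (q ≫ snd _ _ ≫ fst _ _) (lift (q ≫ fst _ _ ≫ fst _ _) (q ≫ fst _ _ ≫ snd _ _)))
    (q ≫ snd _ _ ≫ snd _ _))).obj L.sub⟩

/-- `L` is a double equivalence relation on the equivalence relations `R` and `S`. -/
structure IsDoubleEquivalenceRelation {A : C} (R S : IRel A A) (L : IRel (A ⊗ A ⊗ A) A) :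
    Prop where
  R_equiv : R.IsEquiv
  S_equiv : S.IsEquiv
  R_iff : ∀ {X : C} (x y : X ⟶ A), R.Holds x y ↔ Quad L x y y x
  S_iff : ∀ {X : C} (y z : X ⟶ A), S.Holds y z ↔ Quad L y y z z
  sub : ∀ {X : C} (x y z u : X ⟶ A), Quad L x y z u →
    R.Holds x y ∧ R.Holds z u ∧ S.Holds y z ∧ S.Holds x u
  r_equiv : (horizontal R L).IsEquiv
  l_equiv : (vertical S L).IsEquiv

end Connectors

end

/-! Write `L(x, y, z, u)` for the multiplication `m`, read as a relation on generalised elements and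
pictured as a set of squares with corners `x, y, z, u`. An existential statement in `Rel(C)` is
local: its witness lives on a cover, that is, after a strong epimorphism. In these terms the axioms
become elementary (`IsFrobeniusQuad`): the dagger condition says that `L` is closed under the
reflection `L(u, z, y, x)`, Frobenius symmetry that it is closed under the half-turn `L(z, u, x,
y)`, and normality that `[y, y, z]` and `[x, y, y]` can only be `z` and `x`, with some such loop
existing locally at every element.

Given such an `L`, suppose that `[x, y, z]` has values `u` and `v`. By reflection `[u, z, y] = x`,
so `v = [[u, z, y], y, z] = [u, z, [y, y, z]] = [u, z, z] = u`. Thus `L` is single-valued, and the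
same computation shows that its sides are degenerate squares (`eq_and_refl`). With `R` and `S`
defined by degenerate squares, associativity in the form `[x, y, [z, z, y]] = [[x, y, z], z, y]`
makes `[x, y, z]` defined locally on all of `R ×_A S`. Being unique, the local value descends along
the cover (`exists_of_cover`), and at the universal triple it is the morphism `p`.

Conversely, for a connector, associativity and the two identities give `p(p(x, y, z), z, y) = x` and
`p(y, x, p(x, y, z)) = z`, from which both symmetries of the square follow. -/

namespace IRel

/-! ### Internal equivalence relations through generalised elements -/

section

variable {C : Type u} [Category.{v} C] [CartesianMonoidalCategory C]

theorem holds_arrow {A B : C} (R : IRel A B) :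
    R.Holds (R.sub.arrow ≫ fst A B) (R.sub.arrow ≫ snd A B) :=
  (holds_iff _ _ _).2 ⟨𝟙 _, by simp, by simp⟩

theorem holds_comp_arrow {A B : C} (R : IRel A B) {X : C} (k : X ⟶ (R.sub : C)) :
    R.Holds (k ≫ R.sub.arrow ≫ fst A B) (k ≫ R.sub.arrow ≫ snd A B) :=
  R.holds_arrow.precomp k

instance {A B : C} (R : IRel A B) :
    JointlyMono₂ (R.sub.arrow ≫ fst A B) (R.sub.arrow ≫ snd A B) where
  right_cancellation Y f g h₁ h₂ := by
    rw [← cancel_mono R.sub.arrow]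
    ext
    · simpa using h₁
    · simpa using h₂

theorem eq_iff_holds {A B : C} {R S : IRel A B} :
    R = S ↔ ∀ (X : C) (a : X ⟶ A) (b : X ⟶ B), R.Holds a b ↔ S.Holds a b :=
  ⟨fun h _ _ _ => h ▸ Iff.rfl, ext_holds⟩

theorem IsEquiv.refl {A : C} {R : IRel A A} (h : R.IsEquiv) {X : C} (x : X ⟶ A) :
    R.Holds x x := by
  obtain ⟨⟨e⟩⟩ := h
  exact (holds_iff _ _ _).2 ⟨x ≫ e.r, by simp, by simp⟩

theorem IsEquiv.symm {A : C} {R : IRel A A} (h : R.IsEquiv) {X : C} {x y : X ⟶ A}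
    (hxy : R.Holds x y) : R.Holds y x := by
  obtain ⟨⟨e⟩⟩ := h
  obtain ⟨k, rfl, rfl⟩ := (holds_iff _ _ _).1 hxy
  exact (holds_iff _ _ _).2 ⟨k ≫ e.s, by rw [Category.assoc, e.symmetry₁],
    by rw [Category.assoc, e.symmetry₂]⟩

end

section

variable {C : Type u} [Category.{v} C] [CartesianMonoidalCategory C] [HasPullbacks C]

theorem isEquiv_of_holds {A : C} {R : IRel A A}
    (hr : ∀ {X : C} (x : X ⟶ A), R.Holds x x)
    (hs : ∀ {X : C} (x y : X ⟶ A), R.Holds x y → R.Holds y x)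
    (ht : ∀ {X : C} (x y z : X ⟶ A), R.Holds x y → R.Holds y z → R.Holds x z) :
    R.IsEquiv := by
  -- Each structure morphism is read off at the universal instance of its axiom: the identity of
  -- `A`, the generic pair of `R`, and the generic composable pair.
  obtain ⟨r, hr₁, hr₂⟩ := (holds_iff _ _ _).1 (hr (𝟙 A))
  obtain ⟨s, hs₁, hs₂⟩ := (holds_iff _ _ _).1 (hs _ _ R.holds_arrow)
  let p₁ := R.sub.arrow ≫ fst A A
  let p₂ := R.sub.arrow ≫ snd A A
  have h₁ := R.holds_comp_arrow (pullback.fst p₂ p₁)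
  have h₂ := R.holds_comp_arrow (pullback.snd p₂ p₁)
  rw [← show pullback.fst p₂ p₁ ≫ R.sub.arrow ≫ snd A A = _ from pullback.condition] at h₂
  obtain ⟨t, ht₁, ht₂⟩ := (holds_iff _ _ _).1 (ht _ _ _ h₁ h₂)
  exact ⟨⟨{
    r := r
    reflexivity₁ := hr₁
    reflexivity₂ := hr₂
    s := s
    symmetry₁ := hs₁
    symmetry₂ := hs₂
    c := _
    isLimit := pullbackIsPullback p₂ p₁
    t := t
    transitivity₁ := ht₁
    transitivity₂ := ht₂
    right_cancellation := JointlyMono₂.right_cancellation }⟩⟩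

end

end IRel

/-! ### Ternary operations as quaternary relations -/

section Quad

variable {C : Type u} [Category.{v} C] [CartesianMonoidalCategory C]

theorem holds_iff_quad {A : C} (L : IRel (A ⊗ A ⊗ A) A) {X : C} (w : X ⟶ A ⊗ A ⊗ A)
    (u : X ⟶ A) :
    L.Holds w u ↔ Quad L (w ≫ fst _ _) (w ≫ snd _ _ ≫ fst _ _) (w ≫ snd _ _ ≫ snd _ _) u := by
  unfold Quad
  rw [← comp_lift, ← comp_lift]
  simp

theorem Quad.precomp {A : C} {L : IRel (A ⊗ A ⊗ A) A} {X Y : C} {x y z u : X ⟶ A}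
    (h : Quad L x y z u) (f : Y ⟶ X) : Quad L (f ≫ x) (f ≫ y) (f ≫ z) (f ≫ u) := by
  simpa [Quad] using IRel.Holds.precomp h f

theorem quad_of_cover {A : C} {L : IRel (A ⊗ A ⊗ A) A} {X Y : C} (e : Y ⟶ X) [StrongEpi e]
    {x y z u : X ⟶ A} (h : Quad L (e ≫ x) (e ≫ y) (e ≫ z) (e ≫ u)) : Quad L x y z u :=
  IRel.holds_of_cover e (by simpa [Quad] using h)

theorem quad_ext {A : C} {L M : IRel (A ⊗ A ⊗ A) A}
    (h : ∀ {X : C} (x y z u : X ⟶ A), Quad L x y z u ↔ Quad M x y z u) : L = M :=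
  IRel.ext_holds fun X a b => by rw [holds_iff_quad, holds_iff_quad, h]

end Quad

/-! ### Elementwise form of the rotations and loops -/

namespace RelCategory

variable {C : Type u} [Category.{v} C] [CartesianMonoidalCategory C] [Regular C] {A : C}

/-- The nested units `{(*, ((y, z), (z, y)))}` that bend two strands around to the right. -/
theorem holds_nestedUnitRight {X : C} (t : X ⟶ 𝟙_ C) (b : X ⟶ (A ⊗ A) ⊗ A ⊗ A) :
    ((diagUnit A).comp ((IRel.tensor (IRel.graph (𝟙 A)) ((IRel.graph (λ_ A).inv).comp
      ((IRel.tensor (diagUnit A) (IRel.graph (𝟙 A))).comp (IRel.graph (α_ A A A).hom)))).comp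
      (IRel.graph (α_ A A (A ⊗ A)).inv))).Holds t b ↔
      b ≫ fst _ _ ≫ fst _ _ = b ≫ snd _ _ ≫ snd _ _ ∧
      b ≫ fst _ _ ≫ snd _ _ = b ≫ snd _ _ ≫ fst _ _ := by
  rw [IRel.holds_comp]
  have h0 : (α_ A A (A ⊗ A)).inv = (α_ A A (A ⊗ A)).symm.hom := rfl
  -- `IRel.holds_comp_graph` concerns the `hom` of an isomorphism.
  rw [h0]
  simp only [IRel.holds_graph_comp, IRel.holds_comp_graph, IRel.holds_tensor, IRel.holds_graph,
    holds_diagUnit, Category.assoc, Category.comp_id, Iso.symm_inv, associator_hom_fst,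
    associator_hom_snd_fst, associator_inv_fst_fst, associator_inv_fst_snd, associator_inv_snd,
    leftUnitor_inv_snd]
  constructor
  · rintro ⟨Y, e, he, c, h1, h2, h3, h4⟩
    refine ⟨(cancel_epi e).1 ?_, (cancel_epi e).1 ?_⟩ <;> simp_all
  · rintro ⟨h1, h2⟩
    -- The outer unit carries the value shared by the first and last strands.
    exact ⟨X, 𝟙 X, inferInstance, lift (b ≫ fst _ _ ≫ fst _ _) (b ≫ fst _ _ ≫ fst _ _), by simp_all⟩

/-- The nested units `{(*, ((y, z), (z, y)))}` that bend two strands around to the left. -/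
theorem holds_nestedUnitLeft {X : C} (t : X ⟶ 𝟙_ C) (b : X ⟶ (A ⊗ A) ⊗ A ⊗ A) :
    ((diagUnit A).comp ((IRel.tensor ((IRel.graph (ρ_ A).inv).comp
      ((IRel.tensor (IRel.graph (𝟙 A)) (diagUnit A)).comp (IRel.graph (α_ A A A).inv)))
      (IRel.graph (𝟙 A))).comp (IRel.graph (α_ (A ⊗ A) A A).hom))).Holds t b ↔
      b ≫ fst _ _ ≫ fst _ _ = b ≫ snd _ _ ≫ snd _ _ ∧
      b ≫ fst _ _ ≫ snd _ _ = b ≫ snd _ _ ≫ fst _ _ := by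
  rw [IRel.holds_comp]
  have h0 : (α_ A A A).inv = (α_ A A A).symm.hom := rfl
  rw [h0]
  simp only [IRel.holds_graph_comp, IRel.holds_comp_graph, IRel.holds_tensor, IRel.holds_graph,
    holds_diagUnit, Category.assoc, Category.comp_id, Iso.symm_inv, associator_hom_fst,
    associator_hom_snd_fst, associator_hom_snd_snd, associator_inv_fst_snd,
    associator_inv_snd, rightUnitor_inv_fst]
  constructor
  · rintro ⟨Y, e, he, c, h1, ⟨h2, h3⟩, h4⟩
    refine ⟨(cancel_epi e).1 ?_, (cancel_epi e).1 ?_⟩ <;> simp_all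
  · rintro ⟨h1, h2⟩
    exact ⟨X, 𝟙 X, inferInstance, lift (b ≫ fst _ _ ≫ fst _ _) (b ≫ fst _ _ ≫ fst _ _), by simp_all⟩

/-- The intermediate element is determined by `x` and `w`, so no cover survives in the result. -/
theorem holds_bendRight (L : IRel (A ⊗ A ⊗ A) A) {X : C} (x : X ⟶ A) (w : X ⟶ A ⊗ A ⊗ A) :
    IRel.Holds (A := A) (B := A ⊗ A ⊗ A) ((selfDual A).bendRight L) x w ↔
      Quad L x (w ≫ snd _ _ ≫ snd _ _) (w ≫ snd _ _ ≫ fst _ _) (w ≫ fst _ _) := by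
  -- The composite in `Rel(C)` is definitionally this expression in `IRel`, to which the membership
  -- lemmas apply.
  change ((IRel.graph (ρ_ A).inv).comp ((IRel.tensor (IRel.graph (𝟙 A))
    ((diagUnit A).comp ((IRel.tensor (IRel.graph (𝟙 A)) ((IRel.graph (λ_ A).inv).comp
      ((IRel.tensor (diagUnit A) (IRel.graph (𝟙 A))).comp (IRel.graph (α_ A A A).hom)))).comp
      (IRel.graph (α_ A A (A ⊗ A)).inv)))).comp
    ((IRel.graph (α_ A (A ⊗ A) (A ⊗ A)).inv).comp
      (IRel.tensor L (IRel.graph (𝟙 (A ⊗ A))))))).Holds x w ↔ _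
  rw [IRel.holds_graph_comp, IRel.holds_comp]
  simp only [IRel.holds_graph_comp, IRel.holds_tensor, holds_nestedUnitRight, IRel.holds_graph,
    holds_iff_quad L, Category.assoc, Category.comp_id, associator_inv_fst_fst,
    associator_inv_fst_snd_assoc, associator_inv_snd, rightUnitor_inv_fst]
  constructor
  · rintro ⟨Y, e, he, b, ⟨h1, h2, h3⟩, h4, h5⟩
    apply quad_of_cover e
    have h6 := congrArg (· ≫ fst _ _) h5
    have h7 := congrArg (· ≫ snd _ _) h5
    simp only [Category.assoc] at h6 h7
    simpa only [h1, ← h6, ← h7, ← h2, ← h3] using h4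
  · intro h
    refine ⟨X, 𝟙 X, inferInstance, lift x (lift (lift (w ≫ snd _ _ ≫ snd _ _)
      (w ≫ snd _ _ ≫ fst _ _)) (w ≫ snd _ _)), by simp, by simpa using h, by simp⟩

theorem holds_bendLeft (L : IRel (A ⊗ A ⊗ A) A) {X : C} (x : X ⟶ A) (w : X ⟶ A ⊗ A ⊗ A) :
    IRel.Holds (A := A) (B := A ⊗ A ⊗ A) ((selfDual A).bendLeft L) x w ↔
      Quad L (w ≫ snd _ _ ≫ fst _ _) (w ≫ fst _ _) x (w ≫ snd _ _ ≫ snd _ _) := by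
  change ((IRel.graph (λ_ A).inv).comp ((IRel.tensor
    ((diagUnit A).comp ((IRel.tensor ((IRel.graph (ρ_ A).inv).comp
      ((IRel.tensor (IRel.graph (𝟙 A)) (diagUnit A)).comp (IRel.graph (α_ A A A).inv)))
      (IRel.graph (𝟙 A))).comp (IRel.graph (α_ (A ⊗ A) A A).hom))) (IRel.graph (𝟙 A))).comp
    ((IRel.graph (α_ (A ⊗ A) (A ⊗ A) A).hom).comp
      ((IRel.tensor (IRel.graph (𝟙 (A ⊗ A))) (IRel.graph (α_ A A A).hom)).comp
        ((IRel.tensor (IRel.graph (𝟙 (A ⊗ A))) L).comp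
          (IRel.graph (α_ A A A).hom)))))).Holds x w ↔ _
  rw [IRel.graph_tensor_graph, IRel.holds_graph_comp, IRel.holds_comp]
  simp only [IRel.holds_graph_comp, IRel.holds_comp_graph, IRel.holds_tensor,
    holds_nestedUnitLeft, IRel.holds_graph, holds_iff_quad L, Category.assoc, Category.comp_id]
  constructor
  · rintro ⟨Y, e, he, b, ⟨⟨h2, h3⟩, h1⟩, h5, h4⟩
    apply quad_of_cover e
    have h6 := congrArg (· ≫ fst _ _) h5
    have h7 := congrArg (· ≫ snd _ _) h5
    simp at h1 h2 h3 h4 h6 h7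
    simpa only [h1, ← h6, ← h7, h2, h3] using h4
  · intro h
    refine ⟨X, 𝟙 X, inferInstance, lift (lift (lift (w ≫ fst _ _) (w ≫ snd _ _ ≫ fst _ _))
      (lift (w ≫ snd _ _ ≫ fst _ _) (w ≫ fst _ _))) x, by simp, ?_, by simpa using h⟩
    ext <;> simp

/-- The element running around the loop is not determined by `z` and `u`, so here the cover remains.
-/
theorem holds_leftLoop (L : IRel (A ⊗ A ⊗ A) A) {X : C} (z u : X ⟶ A) :
    IRel.Holds (A := A) (B := A) ((selfDual A).leftLoop L) z u ↔
      ∃ (Y : C) (e : Y ⟶ X) (_ : StrongEpi e) (y : Y ⟶ A), Quad L y y (e ≫ z) (e ≫ u) := by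
  change ((IRel.graph (λ_ A).inv).comp ((IRel.tensor (diagUnit A) (IRel.graph (𝟙 A))).comp
    ((IRel.graph (α_ A A A).hom).comp L))).Holds z u ↔ _
  rw [IRel.holds_graph_comp, IRel.holds_comp]
  simp only [IRel.holds_graph_comp, IRel.holds_tensor, holds_diagUnit, IRel.holds_graph,
    holds_iff_quad L, Category.assoc, Category.comp_id, leftUnitor_inv_snd, associator_hom_fst,
    associator_hom_snd_fst, associator_hom_snd_snd]
  refine exists_congr fun Y => exists_congr fun e => exists_congr fun _ => ?_
  constructor
  · rintro ⟨b, ⟨h1, h2⟩, h3⟩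
    exact ⟨_, by rw [h2]; simpa only [h1] using h3⟩
  · rintro ⟨y, h⟩
    exact ⟨lift (lift y y) (e ≫ z), by simp, by simpa using h⟩

theorem holds_rightLoop (L : IRel (A ⊗ A ⊗ A) A) {X : C} (x u : X ⟶ A) :
    IRel.Holds (A := A) (B := A) ((selfDual A).rightLoop L) x u ↔
      ∃ (Y : C) (e : Y ⟶ X) (_ : StrongEpi e) (y : Y ⟶ A), Quad L (e ≫ x) y y (e ≫ u) := by
  change ((IRel.graph (ρ_ A).inv).comp ((IRel.tensor (IRel.graph (𝟙 A)) (diagUnit A)).comp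
    L)).Holds x u ↔ _
  rw [IRel.holds_graph_comp, IRel.holds_comp]
  simp only [IRel.holds_tensor, holds_diagUnit, IRel.holds_graph,
    holds_iff_quad L, Category.assoc, Category.comp_id, rightUnitor_inv_fst]
  refine exists_congr fun Y => exists_congr fun e => exists_congr fun _ => ?_
  constructor
  · rintro ⟨b, ⟨h1, h2⟩, h3⟩
    exact ⟨_, by rw [h1]; simpa only [h2] using h3⟩
  · rintro ⟨y, h⟩
    exact ⟨lift (e ≫ x) (lift y y), by simp, by simpa using h⟩

end RelCategory

/-! ### Elementwise form of the two iterated multiplications -/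

namespace RelCategory

variable {C : Type u} [Category.{v} C] [CartesianMonoidalCategory C] [Regular C] {A : C}

theorem holds_mulRight (L : IRel (A ⊗ A ⊗ A) A) {X : C} (a : X ⟶ A ⊗ A ⊗ A ⊗ A ⊗ A)
    (w : X ⟶ A) :
    ((IRel.tensor (IRel.graph (𝟙 A)) (IRel.tensor (IRel.graph (𝟙 A)) L)).comp L).Holds a w ↔
      ∃ (Y : C) (e : Y ⟶ X) (_ : StrongEpi e) (t : Y ⟶ A),
        Quad L (e ≫ a ≫ snd _ _ ≫ snd _ _ ≫ fst _ _)
          (e ≫ a ≫ snd _ _ ≫ snd _ _ ≫ snd _ _ ≫ fst _ _)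
          (e ≫ a ≫ snd _ _ ≫ snd _ _ ≫ snd _ _ ≫ snd _ _) t ∧
        Quad L (e ≫ a ≫ fst _ _) (e ≫ a ≫ snd _ _ ≫ fst _ _) t (e ≫ w) := by
  rw [IRel.holds_comp]
  simp only [IRel.holds_tensor, IRel.holds_graph, holds_iff_quad L, Category.assoc,
    Category.comp_id]
  refine exists_congr fun Y => exists_congr fun e => exists_congr fun _ => ?_
  constructor
  · rintro ⟨b, ⟨h1, h2, h3⟩, h4⟩
    exact ⟨_, h3, by simpa only [h1, h2] using h4⟩
  · rintro ⟨t, h, h'⟩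
    exact ⟨lift (e ≫ a ≫ fst _ _) (lift (e ≫ a ≫ snd _ _ ≫ fst _ _) t),
      ⟨by simp, by simp, by simpa using h⟩, by simpa using h'⟩

theorem holds_mulLeft (L : IRel (A ⊗ A ⊗ A) A) {X : C} (a : X ⟶ A ⊗ A ⊗ A ⊗ A ⊗ A)
    (w : X ⟶ A) :
    ((IRel.tensor (IRel.graph (𝟙 A)) (IRel.graph (α_ A A (A ⊗ A)).inv)).comp
      ((IRel.graph (α_ A (A ⊗ A) (A ⊗ A)).inv).comp
        ((IRel.tensor L (IRel.graph (𝟙 (A ⊗ A)))).comp L))).Holds a w ↔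
      ∃ (Y : C) (e : Y ⟶ X) (_ : StrongEpi e) (t : Y ⟶ A),
        Quad L (e ≫ a ≫ fst _ _) (e ≫ a ≫ snd _ _ ≫ fst _ _)
          (e ≫ a ≫ snd _ _ ≫ snd _ _ ≫ fst _ _) t ∧
        Quad L t (e ≫ a ≫ snd _ _ ≫ snd _ _ ≫ snd _ _ ≫ fst _ _)
          (e ≫ a ≫ snd _ _ ≫ snd _ _ ≫ snd _ _ ≫ snd _ _) (e ≫ w) := by
  rw [IRel.graph_tensor_graph, IRel.holds_graph_comp, IRel.holds_graph_comp, IRel.holds_comp]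
  simp only [IRel.holds_tensor, IRel.holds_graph, holds_iff_quad L, Category.assoc,
    Category.comp_id]
  refine exists_congr fun Y => exists_congr fun e => exists_congr fun _ => ?_
  constructor
  · rintro ⟨b, ⟨h1, h2⟩, h3⟩
    have h4 := congrArg (· ≫ fst _ _) h2
    have h5 := congrArg (· ≫ snd _ _) h2
    simp at h1 h4 h5
    exact ⟨_, h1, by simpa [h4, h5] using h3⟩
  · rintro ⟨t, h, h'⟩
    exact ⟨lift t (e ≫ a ≫ snd _ _ ≫ snd _ _ ≫ snd _ _),
      ⟨by simpa using h, by simp⟩, by simpa using h'⟩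

end RelCategory

/-! ### Squares: uniqueness, sides, pasting and descent -/

section

variable {C : Type u} [Category.{v} C] [CartesianMonoidalCategory C] {A : C}

/-- The normal dagger Frobenius 3-structure axioms on a quaternary relation, in the internal
language. -/
structure IsFrobeniusQuad (L : IRel (A ⊗ A ⊗ A) A) : Prop where
  assoc : ∀ {X : C} (x y z u v w : X ⟶ A),
    (∃ (Y : C) (e : Y ⟶ X) (_ : StrongEpi e) (t : Y ⟶ A),
      Quad L (e ≫ z) (e ≫ u) (e ≫ v) t ∧ Quad L (e ≫ x) (e ≫ y) t (e ≫ w)) ↔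
    (∃ (Y : C) (e : Y ⟶ X) (_ : StrongEpi e) (t : Y ⟶ A),
      Quad L (e ≫ x) (e ≫ y) (e ≫ z) t ∧ Quad L t (e ≫ u) (e ≫ v) (e ≫ w))
  flip : ∀ {X : C} {x y z u : X ⟶ A}, Quad L x y z u → Quad L u z y x
  swap : ∀ {X : C} {x y z u : X ⟶ A}, Quad L x y z u → Quad L z u x y
  left_iff : ∀ {X : C} (z u : X ⟶ A),
    (∃ (Y : C) (e : Y ⟶ X) (_ : StrongEpi e) (y : Y ⟶ A), Quad L y y (e ≫ z) (e ≫ u)) ↔ z = u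
  right_iff : ∀ {X : C} (x u : X ⟶ A),
    (∃ (Y : C) (e : Y ⟶ X) (_ : StrongEpi e) (y : Y ⟶ A), Quad L (e ≫ x) y y (e ≫ u)) ↔ x = u

namespace IsFrobeniusQuad

variable {L : IRel (A ⊗ A ⊗ A) A} (hL : IsFrobeniusQuad L)
include hL

variable {X : C} {x y z u v w t : X ⟶ A}

theorem eq_of_left (h : Quad L y y z u) : z = u :=
  (hL.left_iff z u).1 ⟨X, 𝟙 X, inferInstance, y, by simpa using h⟩

theorem eq_of_right (h : Quad L x y y u) : x = u :=
  (hL.right_iff x u).1 ⟨X, 𝟙 X, inferInstance, y, by simpa using h⟩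

theorem exists_left (h : Quad L z u v t) (h' : Quad L x y t w) :
    ∃ (Y : C) (e : Y ⟶ X) (_ : StrongEpi e) (s : Y ⟶ A),
      Quad L (e ≫ x) (e ≫ y) (e ≫ z) s ∧ Quad L s (e ≫ u) (e ≫ v) (e ≫ w) :=
  (hL.assoc x y z u v w).1 ⟨X, 𝟙 X, inferInstance, t, by simpa using h, by simpa using h'⟩

theorem exists_right (h : Quad L x y z t) (h' : Quad L t u v w) :
    ∃ (Y : C) (e : Y ⟶ X) (_ : StrongEpi e) (s : Y ⟶ A),
      Quad L (e ≫ z) (e ≫ u) (e ≫ v) s ∧ Quad L (e ≫ x) (e ≫ y) s (e ≫ w) :=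
  (hL.assoc x y z u v w).2 ⟨X, 𝟙 X, inferInstance, t, by simpa using h, by simpa using h'⟩

/-- Associativity turns `[[u, z, y], y, z]` into `[u, z, [y, y, z]]`. The left loop makes the inner
bracket `z`, and the right loop then makes `[u, z, z]` equal to `u`. The two degenerate squares are
the intermediate steps. -/
theorem eq_and_refl (h : Quad L x y z u) (h' : Quad L x y z v) :
    u = v ∧ Quad L y y z z ∧ Quad L u z z u := by
  obtain ⟨Y, e, he, t, h₁, h₂⟩ := hL.exists_right (hL.flip h) h'
  obtain rfl := hL.eq_of_left h₁
  obtain h₃ := (cancel_epi e).1 (hL.eq_of_right h₂)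
  subst h₃
  exact ⟨rfl, quad_of_cover e h₁, quad_of_cover e h₂⟩

theorem unique (h : Quad L x y z u) (h' : Quad L x y z v) : u = v :=
  (hL.eq_and_refl h h').1

theorem vertical₂₃ (h : Quad L x y z u) : Quad L y y z z := (hL.eq_and_refl h h).2.1

theorem horizontal₄₃ (h : Quad L x y z u) : Quad L u z z u := (hL.eq_and_refl h h).2.2

theorem horizontal₁₂ (h : Quad L x y z u) : Quad L x y y x := hL.horizontal₄₃ (hL.flip h)

theorem horizontal₃₄ (h : Quad L x y z u) : Quad L z u u z := hL.horizontal₁₂ (hL.swap h)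

theorem vertical₁₄ (h : Quad L x y z u) : Quad L x x u u :=
  hL.swap (hL.vertical₂₃ (hL.swap h))

/-- Squares with a common horizontal side `(u, z)` can be pasted. -/
theorem paste_horizontal (h : Quad L x y z u) (h' : Quad L u z v w) : Quad L x y v w := by
  -- `[[x, y, z], z, v] = [x, y, [z, z, v]] = [x, y, v]`.
  obtain ⟨Y, e, he, t, h₁, h₂⟩ := hL.exists_right h h'
  obtain rfl := hL.eq_of_left h₁
  exact quad_of_cover e h₂

/-- Squares with a common vertical side `(x, u)` can be pasted. -/
theorem paste_vertical (h : Quad L x y z u) (h' : Quad L v x u w) : Quad L v y z w := by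
  -- `[v, x, [x, y, z]] = [[v, x, x], y, z] = [v, y, z]`.
  obtain ⟨Y, e, he, t, h₁, h₂⟩ := hL.exists_left h h'
  obtain rfl := hL.eq_of_right h₁
  exact quad_of_cover e h₂

/-- Normality puts some loop `[x, y, y] = x` at `x`, locally; the side joining its first and last
corners is the constant square. -/
theorem quad_self (x : X ⟶ A) : Quad L x x x x := by
  obtain ⟨Y, e, he, y, h⟩ := (hL.right_iff x x).2 rfl
  exact quad_of_cover e (hL.vertical₁₄ h)

/-- Since `[z, z, y] = y`, the value `x = [x, y, y]` is `[x, y, [z, z, y]]`; reassociating it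
requires `[x, y, z]` to exist locally. -/
theorem exists_cover (h : Quad L x y y x) (h' : Quad L y y z z) :
    ∃ (Y : C) (e : Y ⟶ X) (_ : StrongEpi e) (s : Y ⟶ A),
      Quad L (e ≫ x) (e ≫ y) (e ≫ z) s := by
  obtain ⟨Y, e, he, s, hs, -⟩ := hL.exists_left (hL.swap h') h
  exact ⟨Y, e, he, s, hs⟩

theorem mono_arrow_fst : Mono (L.sub.arrow ≫ fst (A ⊗ A ⊗ A) A) where
  right_cancellation g h w := by
    have hg := L.holds_comp_arrow g
    have hh := L.holds_comp_arrow h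
    rw [← w, holds_iff_quad] at hh
    rw [holds_iff_quad] at hg
    exact JointlyMono₂.right_cancellation g h w (hL.unique hg hh)

/-- The value of `L` is unique, so that it exists as soon as it exists on a cover. -/
theorem exists_of_cover {X Y : C} (e : Y ⟶ X) [StrongEpi e] {x y z : X ⟶ A} {s : Y ⟶ A}
    (h : Quad L (e ≫ x) (e ≫ y) (e ≫ z) s) : ∃ u, Quad L x y z u ∧ e ≫ u = s := by
  have := hL.mono_arrow_fst
  -- The domain of a single-valued `L` is a subobject of `A ⊗ A ⊗ A`, and membership in a subobject
  -- can be tested on a cover.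
  have hf : (Subobject.mk (L.sub.arrow ≫ fst (A ⊗ A ⊗ A) A)).Factors (lift x (lift y z)) := by
    apply factors_of_strongEpi _ e
    rw [subobject_mk_factors_iff, comp_lift, comp_lift]
    obtain ⟨k, hk, -⟩ := (IRel.holds_iff _ _ _).1 h
    exact ⟨k, hk⟩
  obtain ⟨k, hk⟩ := (subobject_mk_factors_iff _ _).1 hf
  have hu : Quad L x y z (k ≫ L.sub.arrow ≫ snd _ _) := (IRel.holds_iff _ _ _).2 ⟨k, hk, rfl⟩
  exact ⟨_, hu, hL.unique (hu.precomp e) h⟩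

theorem exists_quad {X : C} {x y z : X ⟶ A} (h : Quad L x y y x) (h' : Quad L y y z z) :
    ∃ u, Quad L x y z u := by
  obtain ⟨Y, e, he, s, hs⟩ := hL.exists_cover h h'
  obtain ⟨u, hu, -⟩ := hL.exists_of_cover e hs
  exact ⟨u, hu⟩

/-- The intermediate value is unique, so the cover in the relational associativity law can be
removed, as a connector requires. -/
theorem exists_assoc_iff {X : C} (x y z u v w : X ⟶ A) :
    (∃ t, Quad L x y z t ∧ Quad L t u v w) ↔ (∃ t, Quad L z u v t ∧ Quad L x y t w) := by
  constructor
  · rintro ⟨t, h, h'⟩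
    obtain ⟨Y, e, he, s, h₁, h₂⟩ := hL.exists_right h h'
    obtain ⟨t', h₃, rfl⟩ := hL.exists_of_cover e h₁
    exact ⟨t', h₃, quad_of_cover e h₂⟩
  · rintro ⟨t, h, h'⟩
    obtain ⟨Y, e, he, s, h₁, h₂⟩ := hL.exists_left h h'
    obtain ⟨t', h₃, rfl⟩ := hL.exists_of_cover e h₁
    exact ⟨t', h₃, quad_of_cover e h₂⟩

end IsFrobeniusQuad
end

/-! ### Translation of the Frobenius axioms -/

noncomputable section

variable {C : Type u} [Category.{v} C] [CartesianMonoidalCategory C] [Regular C] {A : C}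

theorem bendRight_eq_dag_iff (L : IRel (A ⊗ A ⊗ A) A) :
    (RelCategory.selfDual A).bendRight L =
      MonoidalDaggerCategory.dag (X := (⟨A ⊗ A ⊗ A⟩ : RelCategory C)) (Y := ⟨A⟩) L ↔
      ∀ {X : C} (x y z u : X ⟶ A), Quad L x y z u ↔ Quad L u z y x := by
  refine IRel.eq_iff_holds.trans ⟨fun h X x y z u => ?_, fun h X x w => ?_⟩
  -- Bending to the right reverses the last three corners, so the output triple to test is `(u, z,
  -- y)`.
  · have := (RelCategory.holds_bendRight L x (lift u (lift z y))).symm.trans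
      ((h X x _).trans (IRel.holds_converse L _ _))
    simpa [Quad] using this
  · refine (RelCategory.holds_bendRight L x w).trans (Iff.trans ?_
      (IRel.holds_converse L x w).symm)
    rw [holds_iff_quad, h]

theorem bendRight_eq_bendLeft_iff (L : IRel (A ⊗ A ⊗ A) A) :
    (RelCategory.selfDual A).bendRight L = (RelCategory.selfDual A).bendLeft L ↔
      ∀ {X : C} (x y z u : X ⟶ A), Quad L x y z u ↔ Quad L z u x y := by
  refine IRel.eq_iff_holds.trans ⟨fun h X x y z u => ?_, fun h X x w => ?_⟩
  · have := (RelCategory.holds_bendRight L x (lift u (lift z y))).symm.trans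
      ((h X x _).trans (RelCategory.holds_bendLeft L _ _))
    simpa using this
  · exact (RelCategory.holds_bendRight L x w).trans
      ((h _ _ _ _).trans (RelCategory.holds_bendLeft L x w).symm)

theorem leftLoop_eq_id_iff (L : IRel (A ⊗ A ⊗ A) A) :
    (RelCategory.selfDual A).leftLoop L = 𝟙 (⟨A⟩ : RelCategory C) ↔
      ∀ {X : C} (z u : X ⟶ A), (∃ (Y : C) (e : Y ⟶ X) (_ : StrongEpi e) (y : Y ⟶ A),
        Quad L y y (e ≫ z) (e ≫ u)) ↔ z = u := by
  refine IRel.eq_iff_holds.trans (forall_congr' fun X => forall₂_congr fun z u => ?_)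
  exact iff_congr (RelCategory.holds_leftLoop L z u)
    ((IRel.holds_graph (𝟙 A) z u).trans (by rw [Category.comp_id]))

theorem rightLoop_eq_id_iff (L : IRel (A ⊗ A ⊗ A) A) :
    (RelCategory.selfDual A).rightLoop L = 𝟙 (⟨A⟩ : RelCategory C) ↔
      ∀ {X : C} (x u : X ⟶ A), (∃ (Y : C) (e : Y ⟶ X) (_ : StrongEpi e) (y : Y ⟶ A),
        Quad L (e ≫ x) y y (e ≫ u)) ↔ x = u := by
  refine IRel.eq_iff_holds.trans (forall_congr' fun X => forall₂_congr fun z u => ?_)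
  exact iff_congr (RelCategory.holds_rightLoop L z u)
    ((IRel.holds_graph (𝟙 A) z u).trans (by rw [Category.comp_id]))

theorem mul_assoc_iff (L : IRel (A ⊗ A ⊗ A) A) :
    (IRel.tensor (IRel.graph (𝟙 A)) (IRel.tensor (IRel.graph (𝟙 A)) L)).comp L =
      (IRel.tensor (IRel.graph (𝟙 A)) (IRel.graph (α_ A A (A ⊗ A)).inv)).comp
        ((IRel.graph (α_ A (A ⊗ A) (A ⊗ A)).inv).comp
          ((IRel.tensor L (IRel.graph (𝟙 (A ⊗ A)))).comp L)) ↔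
    ∀ {X : C} (x y z u v w : X ⟶ A),
      (∃ (Y : C) (e : Y ⟶ X) (_ : StrongEpi e) (t : Y ⟶ A),
        Quad L (e ≫ z) (e ≫ u) (e ≫ v) t ∧ Quad L (e ≫ x) (e ≫ y) t (e ≫ w)) ↔
      (∃ (Y : C) (e : Y ⟶ X) (_ : StrongEpi e) (t : Y ⟶ A),
        Quad L (e ≫ x) (e ≫ y) (e ≫ z) t ∧ Quad L t (e ≫ u) (e ≫ v) (e ≫ w)) := by
  refine IRel.eq_iff_holds.trans ⟨fun h X x y z u v w => ?_, fun h X x w => ?_⟩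
  · have := h X (lift x (lift y (lift z (lift u v)))) w
    rw [RelCategory.holds_mulRight, RelCategory.holds_mulLeft] at this
    simpa using this
  · rw [RelCategory.holds_mulRight, RelCategory.holds_mulLeft, h]

theorem isDagger_selfDual (A : C) : (RelCategory.selfDual A).IsDagger :=
  ⟨(MonoidalDaggerCategory.dag_dag (D := RelCategory C) (X := ⟨𝟙_ C⟩) (Y := ⟨A ⊗ A⟩)
    (RelCategory.diagUnit A)).symm, rfl⟩

theorem NormalDaggerFrobenius3Structure.isFrobeniusQuad
    (F : NormalDaggerFrobenius3Structure (RelCategory.selfDual A)) :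
    IsFrobeniusQuad (A := A) F.1.mul where
  assoc := (mul_assoc_iff _).1 F.1.assoc
  flip := ((bendRight_eq_dag_iff _).1 F.2.1.2 _ _ _ _).1
  swap := ((bendRight_eq_bendLeft_iff _).1 F.1.symm _ _ _ _).1
  left_iff := (leftLoop_eq_id_iff _).1 F.2.2.1
  right_iff := (rightLoop_eq_id_iff _).1 F.2.2.2

/-- The normal dagger Frobenius 3-structure with a given multiplication. -/
def IsFrobeniusQuad.toNormalDaggerFrobenius3Structure
    {L : IRel (A ⊗ A ⊗ A) A} (hL : IsFrobeniusQuad L) :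
    NormalDaggerFrobenius3Structure (RelCategory.selfDual A) :=
  ⟨{mul := L
    assoc := (mul_assoc_iff L).2 hL.assoc
    symm := (bendRight_eq_bendLeft_iff L).2 fun _ _ _ _ => ⟨hL.swap, hL.swap⟩},
   ⟨isDagger_selfDual A, (bendRight_eq_dag_iff L).2 fun _ _ _ _ => ⟨hL.flip, hL.flip⟩⟩,
   (leftLoop_eq_id_iff L).2 hL.left_iff, (rightLoop_eq_id_iff L).2 hL.right_iff⟩

end

/-! ### From connectors to Frobenius structures -/

noncomputable section

variable {C : Type u} [Category.{v} C] [CartesianMonoidalCategory C] [Regular C] {A : C}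

theorem exists_comp_tripleMap_iff {R S : IRel A A} {X : C} (x y z : X ⟶ A) :
    (∃ k : X ⟶ tripleObj R S, k ≫ tripleMap R S = lift x (lift y z)) ↔
      R.Holds x y ∧ S.Holds y z := by
  constructor
  · rintro ⟨k, hk⟩
    have h₁ := congrArg (· ≫ fst _ _) hk
    have h₂ := congrArg (· ≫ snd _ _ ≫ fst _ _) hk
    have h₃ := congrArg (· ≫ snd _ _ ≫ snd _ _) hk
    simp only [tripleMap, Category.assoc, lift_fst, lift_snd, lift_snd_assoc] at h₁ h₂ h₃
    refine ⟨(R.holds_iff _ _).2 ⟨k ≫ pullback.fst _ _, by simpa using h₁, by simpa using h₂⟩,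
      (S.holds_iff _ _).2 ⟨k ≫ pullback.snd _ _, ?_, by simpa using h₃⟩⟩
    rw [← h₂, pullback.condition, Category.assoc]
  · rintro ⟨hR, hS⟩
    obtain ⟨k, rfl, rfl⟩ := (R.holds_iff _ _).1 hR
    obtain ⟨l, hl, rfl⟩ := (S.holds_iff _ _).1 hS
    refine ⟨pullback.lift k l (by simp [hl]), ?_⟩
    simp only [tripleMap, comp_lift, pullback.lift_fst_assoc, pullback.lift_snd_assoc]

section Yields

variable {R S : IRel A A} {p : tripleObj R S ⟶ A} {X : C} {x y z u v : X ⟶ A}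

theorem Yields.holds (h : Yields p x y z u) : R.Holds x y ∧ S.Holds y z :=
  (exists_comp_tripleMap_iff x y z).1 ⟨h.choose, h.choose_spec.1⟩

theorem exists_yields (p : tripleObj R S ⟶ A) (hR : R.Holds x y) (hS : S.Holds y z) :
    ∃ u, Yields p x y z u := by
  obtain ⟨k, hk⟩ := (exists_comp_tripleMap_iff x y z).2 ⟨hR, hS⟩
  exact ⟨k ≫ p, k, hk, rfl⟩

theorem Yields.unique (h : Yields p x y z u) (h' : Yields p x y z v) : u = v := by
  obtain ⟨k, hk, rfl⟩ := h
  obtain ⟨l, hl, rfl⟩ := h'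
  rw [(cancel_mono (tripleMap R S)).1 (hk.trans hl.symm)]

end Yields

namespace Connector

variable (c : Connector A)

theorem quad_toRel_iff {X : C} (x y z u : X ⟶ A) :
    Quad c.toRel x y z u ↔ Yields c.p x y z u := by
  unfold Quad IRel.Holds toRel
  rw [subobject_mk_factors_iff]
  refine exists_congr fun k => ?_
  rw [comp_lift]
  constructor
  · intro h
    exact ⟨by simpa using congrArg (· ≫ fst _ _) h, by simpa using congrArg (· ≫ snd _ _) h⟩
  · rintro ⟨h, h'⟩
    rw [h, h']

variable {c} {X : C} {x y z u : X ⟶ A}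

theorem yields_right (h : c.R.Holds x y) : Yields c.p x y y x := by
  obtain ⟨u, hu⟩ := exists_yields c.p h (c.S_equiv.refl y)
  rwa [c.p_right _ _ _ hu] at hu

theorem yields_left (h : c.S.Holds y z) : Yields c.p y y z z := by
  obtain ⟨u, hu⟩ := exists_yields c.p (c.R_equiv.refl y) h
  rwa [c.p_left _ _ _ hu] at hu

/-- `p(p(x, y, z), z, y) = p(x, y, p(z, z, y)) = p(x, y, y) = x`. The right-hand side is visibly
defined, and the associativity law transfers definedness to the left. -/
theorem yields_flip (h : Yields c.p x y z u) : Yields c.p u z y x := by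
  obtain ⟨t, ht, h'⟩ := (c.p_assoc x y z z y x).2
    ⟨y, yields_left (c.S_equiv.symm h.holds.2), yields_right h.holds.1⟩
  rwa [h.unique ht]

/-- The fourth vertex `u = p(x, y, z)` satisfies `p(y, x, u) = z`. -/
theorem yields_reflect (h : Yields c.p x y z u) : Yields c.p y x u z := by
  -- `p(y, x, p(x, y, z)) = p(p(y, x, x), y, z) = p(y, y, z) = z`.
  obtain ⟨t, ht, h'⟩ := (c.p_assoc y x x y z z).1
    ⟨y, yields_right (c.R_equiv.symm h.holds.1), yields_left h.holds.2⟩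
  rwa [h.unique ht]

theorem isFrobeniusQuad_toRel (c : Connector A) : IsFrobeniusQuad c.toRel where
  assoc x y z u v w := by
    simp only [quad_toRel_iff, c.p_assoc]
  flip h := (c.quad_toRel_iff _ _ _ _).2 (yields_flip ((c.quad_toRel_iff _ _ _ _).1 h))
  swap h := (c.quad_toRel_iff _ _ _ _).2
    (yields_flip (yields_reflect ((c.quad_toRel_iff _ _ _ _).1 h)))
  left_iff z u := by
    simp only [quad_toRel_iff]
    constructor
    · rintro ⟨Y, e, he, y, h⟩
      exact ((cancel_epi e).1 (c.p_left _ _ _ h)).symm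
    · rintro rfl
      exact ⟨_, 𝟙 _, inferInstance, z, by simpa using yields_left (c.S_equiv.refl z)⟩
  right_iff x u := by
    simp only [quad_toRel_iff]
    constructor
    · rintro ⟨Y, e, he, y, h⟩
      exact ((cancel_epi e).1 (c.p_right _ _ _ h)).symm
    · rintro rfl
      exact ⟨_, 𝟙 _, inferInstance, x, by simpa using yields_right (c.R_equiv.refl x)⟩

theorem R_holds_iff (c : Connector A) {X : C} (x y : X ⟶ A) :
    c.R.Holds x y ↔ Quad c.toRel x y y x := by
  rw [quad_toRel_iff]
  exact ⟨yields_right, fun h => h.holds.1⟩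

theorem S_holds_iff (c : Connector A) {X : C} (y z : X ⟶ A) :
    c.S.Holds y z ↔ Quad c.toRel y y z z := by
  rw [quad_toRel_iff]
  exact ⟨yields_left, fun h => h.holds.2⟩

/-- The degenerate squares recover `R` and `S`, hence the domain of `p`; the remaining squares
determine `p`. -/
theorem toRel_injective : Function.Injective (toRel (A := A)) := by
  intro c c' h
  have hR : c.R = c'.R := IRel.ext_holds fun X x y => by
    rw [R_holds_iff, R_holds_iff, h]
  have hS : c.S = c'.S := IRel.ext_holds fun X x y => by
    rw [S_holds_iff, S_holds_iff, h]
  have hp {X : C} (x y z u : X ⟶ A) (H : Yields c.p x y z u) : Yields c'.p x y z u := by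
    rw [← quad_toRel_iff] at H ⊢
    rwa [← h]
  obtain ⟨R, S, hR₁, hS₁, p⟩ := c
  obtain ⟨R', S', hR₁', hS₁', p'⟩ := c'
  dsimp only at hR hS hp
  subst hR hS
  have : p = p' := by
    let q := tripleMap R S
    -- Compare `p` and `p'` at the universal triple, where the classifying map `k` must be the
    -- identity because `tripleMap` is mono.
    obtain ⟨k, hk, hk'⟩ := hp (q ≫ fst _ _) (q ≫ snd _ _ ≫ fst _ _) (q ≫ snd _ _ ≫ snd _ _) p
      ⟨𝟙 _, by simp [← comp_lift, q], by simp⟩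
    have hk₁ : k = 𝟙 _ := by
      rw [← cancel_mono (tripleMap R S), hk]
      simp [← comp_lift, q]
    rw [← hk', hk₁, Category.id_comp]
  subst this
  rfl

end Connector

/-! ### The double equivalence relation of squares -/

theorem holds_horizontal (R : IRel A A) (L : IRel (A ⊗ A ⊗ A) A) {X : C}
    (a b : X ⟶ (R.sub : C)) :
    (horizontal R L).Holds a b ↔ Quad L (a ≫ R.sub.arrow ≫ fst _ _) (a ≫ R.sub.arrow ≫ snd _ _)
      (b ≫ R.sub.arrow ≫ snd _ _) (b ≫ R.sub.arrow ≫ fst _ _) := by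
  unfold Quad IRel.Holds horizontal
  rw [pullback_factors_iff]
  simp [comp_lift]

theorem holds_vertical (S : IRel A A) (L : IRel (A ⊗ A ⊗ A) A) {X : C}
    (a b : X ⟶ (S.sub : C)) :
    (vertical S L).Holds a b ↔ Quad L (b ≫ S.sub.arrow ≫ fst _ _) (a ≫ S.sub.arrow ≫ fst _ _)
      (a ≫ S.sub.arrow ≫ snd _ _) (b ≫ S.sub.arrow ≫ snd _ _) := by
  unfold Quad IRel.Holds vertical
  rw [pullback_factors_iff]
  simp [comp_lift]

/-- Reflexivity comes from degenerate squares, symmetry from the symmetries of the square, and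
transitivity from pasting. -/
theorem IsFrobeniusQuad.isDoubleEquivalenceRelation {L : IRel (A ⊗ A ⊗ A) A}
    (hL : IsFrobeniusQuad L) {R S : IRel A A}
    (hR : ∀ {X : C} (x y : X ⟶ A), R.Holds x y ↔ Quad L x y y x)
    (hS : ∀ {X : C} (y z : X ⟶ A), S.Holds y z ↔ Quad L y y z z) :
    IsDoubleEquivalenceRelation R S L where
  R_equiv := by
    refine IRel.isEquiv_of_holds (fun x => ?_) (fun x y => ?_) (fun x y z => ?_)
    · simpa [hR] using hL.quad_self x
    · simpa [hR] using fun h => hL.flip (hL.swap h)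
    · simpa [hR] using fun h h' => hL.paste_vertical h' h
  S_equiv := by
    refine IRel.isEquiv_of_holds (fun x => ?_) (fun x y => ?_) (fun x y z => ?_)
    · simpa [hS] using hL.quad_self x
    · simpa [hS] using fun h => hL.flip h
    · simpa [hS] using fun h h' => hL.paste_horizontal h h'
  R_iff := hR
  S_iff := hS
  sub x y z u h := by
    simp only [hR, hS]
    exact ⟨hL.horizontal₁₂ h, hL.horizontal₃₄ h, hL.vertical₂₃ h, hL.vertical₁₄ h⟩
  r_equiv := by
    refine IRel.isEquiv_of_holds (fun x => ?_) (fun x y => ?_) (fun x y z => ?_) <;>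
      simp only [holds_horizontal]
    · exact (hR _ _).1 (R.holds_comp_arrow x)
    · exact hL.flip
    · exact hL.paste_horizontal
  l_equiv := by
    refine IRel.isEquiv_of_holds (fun x => ?_) (fun x y => ?_) (fun x y z => ?_) <;>
      simp only [holds_vertical]
    · exact (hS _ _).1 (S.holds_comp_arrow x)
    · exact fun h => hL.flip (hL.swap h)
    · exact hL.paste_vertical

theorem Connector.isDoubleEquivalenceRelation (c : Connector A) :
    IsDoubleEquivalenceRelation c.R c.S c.toRel :=
  c.isFrobeniusQuad_toRel.isDoubleEquivalenceRelation c.R_holds_iff c.S_holds_iff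

/-- The horizontal sides `{(x, y) | L(x, y, y, x)}` of a quaternary relation. -/
def horizontalSides (L : IRel (A ⊗ A ⊗ A) A) : IRel A A :=
  ⟨(Subobject.pullback (lift (lift (fst A A) (lift (snd A A) (snd A A))) (fst A A))).obj L.sub⟩

theorem holds_horizontalSides (L : IRel (A ⊗ A ⊗ A) A) {X : C} (x y : X ⟶ A) :
    (horizontalSides L).Holds x y ↔ Quad L x y y x := by
  unfold Quad IRel.Holds horizontalSides
  rw [pullback_factors_iff]
  simp [comp_lift]

/-- The vertical sides `{(y, z) | L(y, y, z, z)}` of a quaternary relation. -/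
def verticalSides (L : IRel (A ⊗ A ⊗ A) A) : IRel A A :=
  ⟨(Subobject.pullback (lift (lift (fst A A) (lift (fst A A) (snd A A))) (snd A A))).obj L.sub⟩

theorem holds_verticalSides (L : IRel (A ⊗ A ⊗ A) A) {X : C} (y z : X ⟶ A) :
    (verticalSides L).Holds y z ↔ Quad L y y z z := by
  unfold Quad IRel.Holds verticalSides
  rw [pullback_factors_iff]
  simp [comp_lift]

/-! ### From Frobenius structures to connectors -/

namespace IsFrobeniusQuad

variable {L : IRel (A ⊗ A ⊗ A) A} (hL : IsFrobeniusQuad L)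
include hL

theorem exists_op : ∃ p : tripleObj (horizontalSides L) (verticalSides L) ⟶ A,
    ∀ {X : C} (x y z u : X ⟶ A), Yields p x y z u ↔ Quad L x y z u := by
  let q := tripleMap (horizontalSides L) (verticalSides L)
  obtain ⟨h, h'⟩ := (exists_comp_tripleMap_iff (R := horizontalSides L) (S := verticalSides L)
    (q ≫ fst _ _) (q ≫ snd _ _ ≫ fst _ _) (q ≫ snd _ _ ≫ snd _ _)).1
      ⟨𝟙 _, by simp [← comp_lift, q]⟩
  -- The value at the universal triple of `R ×_A S` is the operation itself.
  obtain ⟨p, hp⟩ := hL.exists_quad ((holds_horizontalSides _ _ _).1 h)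
    ((holds_verticalSides _ _ _).1 h')
  rw [← holds_iff_quad] at hp
  have key {X : C} {x y z u : X ⟶ A} (H : Yields p x y z u) : Quad L x y z u := by
    obtain ⟨k, hk, rfl⟩ := H
    have := hp.precomp k
    rwa [hk] at this
  refine ⟨p, fun x y z u => ⟨key, fun H => ?_⟩⟩
  -- The sides of a square put its first three corners in `R ×_A S`; uniqueness identifies the
  -- fourth with the value of `p`.
  obtain ⟨v, hv⟩ := exists_yields p ((holds_horizontalSides _ _ _).2 (hL.horizontal₁₂ H))
    ((holds_verticalSides _ _ _).2 (hL.vertical₂₃ H))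
  rwa [hL.unique H (key hv)]

theorem exists_connector : ∃ c : Connector A, c.toRel = L := by
  obtain ⟨p, hp⟩ := hL.exists_op
  have hD := hL.isDoubleEquivalenceRelation (holds_horizontalSides L) (holds_verticalSides L)
  refine ⟨{
    R := horizontalSides L
    S := verticalSides L
    R_equiv := hD.R_equiv
    S_equiv := hD.S_equiv
    p := p
    S_p := fun x y z u h => (hD.sub x y z u ((hp _ _ _ _).1 h)).2.2.2
    R_p := fun x y z u h => (hD.sub x y z u ((hp _ _ _ _).1 h)).2.1
    p_right := fun x y u h => (hL.eq_of_right ((hp _ _ _ _).1 h)).symm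
    p_left := fun y z u h => (hL.eq_of_left ((hp _ _ _ _).1 h)).symm
    p_assoc := fun x y z u v w => by
      simpa only [hp] using hL.exists_assoc_iff x y z u v w }, ?_⟩
  exact quad_ext fun x y z u => by rw [Connector.quad_toRel_iff, hp]

end IsFrobeniusQuad

end

theorem mainTheorem2 {C : Type u} [Category.{v} C] [CartesianMonoidalCategory C] [Regular C]
    (A : C) :
    ∃ e : Connector A ≃ NormalDaggerFrobenius3Structure (RelCategory.selfDual A),
      ∀ c : Connector A,
        (e c).1.mul = c.toRel ∧ IsDoubleEquivalenceRelation c.R c.S (e c).1.mul := by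
  let f : Connector A → NormalDaggerFrobenius3Structure (RelCategory.selfDual A) :=
    fun c => c.isFrobeniusQuad_toRel.toNormalDaggerFrobenius3Structure
  have hf : Function.Bijective f := by
    refine ⟨fun c c' h => Connector.toRel_injective (congrArg (·.1.mul) h), fun F => ?_⟩
    obtain ⟨c, hc⟩ := F.isFrobeniusQuad.exists_connector
    -- All fields of a normal dagger Frobenius structure other than the multiplication are
    -- propositions.
    exact ⟨c, Subtype.ext (Frobenius3Structure.ext hc)⟩
  exact ⟨Equiv.ofBijective f hf, fun c => ⟨rfl, c.isDoubleEquivalenceRelation⟩⟩
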